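/- All graphs are finite and simple. A graph $G$ is \emph{1-perfectly orientable} if its edges can be oriented, each in exactly one direction, so that for every vertex $v$ the out-neighborhood of $v$ is a clique in $G$. A function $f:\mathbb{N}\to\mathbb{N}$ is a \emph{$(\mathrm{tw},\omega)$-binding function} for a class $\mathcal{G}$ of graphs if $\mathrm{tw}(G')\le f(\omega(G'))$ for every $G\in\mathcal{G}$ and every induced subgraph $G'$ of $G$, where $\mathrm{tw}$ denotes treewidth and $\omega$ the clique number; the class $\mathcal{G}$ is \emph{$(\mathrm{tw},\omega)$-bounded} if it has such a function. Let $R(k,\ell)$ be the Ramsey number, that is, the least positive integer $n$ such that every graph with at least $n$ vertices contains a clique of size $k$ or an independent set of size $\ell$. Corollary. The class of 1-perfectly orientable graphs is $(\mathrm{tw},\omega)$-bounded, with binding function \[ f(k)=\max\{k,\,2R(k+1,3)-2\}-1 \qquad (k\ge 1). \] (For the graph with no vertices, whose clique number is $0$, we put $\mathrm{tw}=0$ and $f(0)=0$.) This answers affirmatively a question of Brešar, Hartinger, Kos and Milanič, who asked whether this class is $(\mathrm{tw},\omega)$-bounded. -/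

import Mathlib

universe u

/-- `n` is a Ramsey bound for `(k, l)`: every finite graph with at least `n` vertices contains a
clique of size `k` or an independent set of size `l`. -/
def IsRamseyBound (k l n : ℕ) : Prop :=
  ∀ (V : Type) [Fintype V] (G : SimpleGraph V), n ≤ Fintype.card V →
    (∃ s : Finset V, G.IsNClique k s) ∨ (∃ s : Finset V, G.IsNIndepSet l s)

/-- The Ramsey number `R(k, l)`: the least positive integer `n` such that every graph with at least
`n` vertices contains a clique of size `k` or an independent set of size `l`. -/
noncomputable def ramseyNumber (k l : ℕ) : ℕ :=
  sInf {n : ℕ | 0 < n ∧ IsRamseyBound k l n}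

/-- Ramsey's theorem, inside a finite set of vertices. -/
theorem exists_ramsey_finset (k l : ℕ) : ∃ n : ℕ, 0 < n ∧
    ∀ (V : Type) (G : SimpleGraph V) (A : Finset V), n ≤ A.card →
      (∃ s ⊆ A, G.IsNClique k s) ∨ (∃ s ⊆ A, G.IsNIndepSet l s) := by
  classical
  induction k generalizing l with
  | zero =>
    exact ⟨1, one_pos, fun V G A _ => Or.inl ⟨∅, by simp, by simp⟩⟩
  | succ k ihk =>
    induction l with
    | zero =>
      exact ⟨1, one_pos, fun V G A _ => Or.inr ⟨∅, by simp, by simp [SimpleGraph.isNIndepSet_iff]⟩⟩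
    | succ l ihl =>
      obtain ⟨n₁, hn₁, h₁⟩ := ihk (l + 1)
      obtain ⟨n₂, hn₂, h₂⟩ := ihl
      refine ⟨n₁ + n₂, by omega, fun V G A hA => ?_⟩
      obtain ⟨v, hv⟩ : A.Nonempty := Finset.card_pos.mp (by omega)
      have hc := Finset.card_filter_add_card_filter_not (s := A.erase v) (G.Adj v)
      rw [Finset.card_erase_of_mem hv] at hc
      have hcase : n₁ ≤ ((A.erase v).filter (G.Adj v)).card ∨
          n₂ ≤ ((A.erase v).filter (fun w => ¬ G.Adj v w)).card := by omega
      rcases hcase with h | h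
      · rcases h₁ V G _ h with ⟨s, hs, hcl⟩ | ⟨s, hs, hi⟩
        · refine Or.inl ⟨insert v s, ?_, hcl.insert fun w hw => (Finset.mem_filter.mp (hs hw)).2⟩
          intro w hw
          rcases Finset.mem_insert.mp hw with rfl | hw
          · exact hv
          · exact Finset.mem_of_mem_erase (Finset.mem_filter.mp (hs hw)).1
        · exact Or.inr ⟨s, fun w hw =>
            Finset.mem_of_mem_erase (Finset.mem_filter.mp (hs hw)).1, hi⟩
      · rcases h₂ V G _ h with ⟨s, hs, hcl⟩ | ⟨s, hs, hi⟩
        · exact Or.inl ⟨s, fun w hw =>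
            Finset.mem_of_mem_erase (Finset.mem_filter.mp (hs hw)).1, hcl⟩
        · refine Or.inr ⟨insert v s, ?_, ?_⟩
          · intro w hw
            rcases Finset.mem_insert.mp hw with rfl | hw
            · exact hv
            · exact Finset.mem_of_mem_erase (Finset.mem_filter.mp (hs hw)).1
          · rw [← SimpleGraph.isNClique_compl] at hi ⊢
            refine hi.insert fun w hw => ?_
            have hw' := Finset.mem_filter.mp (hs hw)
            exact (SimpleGraph.compl_adj _ _ _).mpr ⟨(Finset.ne_of_mem_erase hw'.1).symm, hw'.2⟩

/-- Ramsey's theorem: the set whose infimum is `ramseyNumber k l` is nonempty, so `ramseyNumber k l`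
is its least element. -/
theorem ramseyNumber_isLeast (k l : ℕ) :
    IsLeast {n : ℕ | 0 < n ∧ IsRamseyBound k l n} (ramseyNumber k l) := by
  have hne : {n : ℕ | 0 < n ∧ IsRamseyBound k l n}.Nonempty := by
    obtain ⟨n, hn, h⟩ := exists_ramsey_finset k l
    refine ⟨n, hn, fun V _ G hc => ?_⟩
    rcases h V G Finset.univ (by simpa using hc) with ⟨s, -, hs⟩ | ⟨s, -, hs⟩
    · exact Or.inl ⟨s, hs⟩
    · exact Or.inr ⟨s, hs⟩
  exact ⟨Nat.sInf_mem hne, fun _ hn => Nat.sInf_le hn⟩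

/-- A tree decomposition of `G`: a finite tree together with a finite set of vertices of `G`
(a bag) for each of its nodes. -/
structure TreeDecomposition {V : Type u} (G : SimpleGraph V) where
  /-- the nodes of the tree -/
  Node : Type
  [fintypeNode : Fintype Node]
  /-- the tree -/
  tree : SimpleGraph Node
  isTree : tree.IsTree
  /-- the bags -/
  bag : Node → Finset V
  /-- every vertex lies in some bag -/
  vertex_mem : ∀ v : V, ∃ t, v ∈ bag t
  /-- both ends of every edge lie in a common bag -/
  edge_mem : ∀ u v : V, G.Adj u v → ∃ t, u ∈ bag t ∧ v ∈ bag t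
  /-- the nodes whose bags contain a given vertex induce a connected subtree -/
  connected : ∀ v : V, (tree.induce {t | v ∈ bag t}).Connected

attribute [instance] TreeDecomposition.fintypeNode

/-- The width of a tree decomposition: the maximum size of a bag, minus one. (The subtraction is
truncated only if all bags are empty, which happens only for the graph with no vertices.) -/
def TreeDecomposition.width {V : Type u} {G : SimpleGraph V} (D : TreeDecomposition G) : ℕ :=
  (Finset.univ.sup fun t : D.Node => (D.bag t).card) - 1

/-- The treewidth of a finite graph: the minimum width of a tree decomposition. -/
noncomputable def treewidth {V : Type u} (G : SimpleGraph V) : ℕ :=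
  sInf {w : ℕ | ∃ D : TreeDecomposition G, D.width = w}

/-- A finite graph has a tree decomposition, with a single bag. -/
theorem nonempty_treeDecomposition {V : Type u} [Finite V] (G : SimpleGraph V) :
    Nonempty (TreeDecomposition G) := by
  classical
  cases nonempty_fintype V
  exact ⟨{ Node := Unit
           tree := ⊥
           isTree := SimpleGraph.IsTree.of_subsingleton
           bag := fun _ => Finset.univ
           vertex_mem := fun v => ⟨(), Finset.mem_univ v⟩
           edge_mem := fun u v _ => ⟨(), Finset.mem_univ u, Finset.mem_univ v⟩
           connected := fun v =>
             { preconnected := fun a b => by rw [Subsingleton.elim a b]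
               nonempty := ⟨⟨(), Finset.mem_univ v⟩⟩ } }⟩

/-- The minimum in the definition of the treewidth of a finite graph is attained. -/
theorem treewidth_isLeast {V : Type u} [Finite V] (G : SimpleGraph V) :
    IsLeast {w : ℕ | ∃ D : TreeDecomposition G, D.width = w} (treewidth G) := by
  obtain ⟨D⟩ := nonempty_treeDecomposition G
  exact ⟨Nat.sInf_mem ⟨D.width, D, rfl⟩, fun _ hn => Nat.sInf_le hn⟩

/-- `D` is an orientation of `G`: every edge of `G` receives exactly one of its two directions. -/
structure IsOrientation {V : Type u} (D : Digraph V) (G : SimpleGraph V) : Prop where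
  adj_iff : ∀ u v : V, G.Adj u v ↔ D.Adj u v ∨ D.Adj v u
  asymm : ∀ u v : V, D.Adj u v → ¬ D.Adj v u

/-- `G` is 1-perfectly orientable: it has an orientation in which the out-neighborhood of every
vertex is a clique of `G`. -/
def IsOnePerfectlyOrientable {V : Type u} (G : SimpleGraph V) : Prop :=
  ∃ D : Digraph V, IsOrientation D G ∧ ∀ v : V, G.IsClique {w | D.Adj v w}

/-- `f` is a `(tw, ω)`-binding function for the class of finite graphs with the property `𝒢`. -/
def IsTwOmegaBindingFunction (𝒢 : ∀ {V : Type u}, SimpleGraph V → Prop) (f : ℕ → ℕ) : Prop :=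
  ∀ (V : Type u) [Finite V] (G : SimpleGraph V), 𝒢 G →
    ∀ s : Set V, treewidth (G.induce s) ≤ f (G.induce s).cliqueNum

/-- The class of finite graphs with the property `𝒢` is `(tw, ω)`-bounded. -/
def IsTwOmegaBounded (𝒢 : ∀ {V : Type u}, SimpleGraph V → Prop) : Prop :=
  ∃ f : ℕ → ℕ, IsTwOmegaBindingFunction 𝒢 f

/-!
Orient `G` so that all out-neighborhoods are cliques. If `F` induces a connected subgraph, then any
two nonempty subsets of `F` closed under following arcs inside `F` intersect; applied to the
neighborhoods in `F` of two vertices outside `F` that send no arc into `F`, this shows that the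
vertices of the boundary of `F` that send no arc into `F` form a clique. So the boundary of `F` is
covered by two cliques as soon as the vertices sending arcs into `F` form a clique.

A tree decomposition arises by exploring `G`, one component `C` of the unexplored part at a time,
while maintaining that the vertices sending arcs into each such component form a clique. For a
component `E` of the subgraph induced by the non-neighbors in `C` of a suitable vertex `y`, the next
bag consists of the boundary of `C` together with the vertices of `C` in the boundary of `E`. It is
covered by four cliques, whence `tw ≤ 4ω - 1`. The disjoint union of two cliques of size `k` shows
`2k < R(k + 1, 3)`, so this bound is at least as good as the one in terms of Ramsey numbers.
-/

section Components

variable {V : Type*} {G : SimpleGraph V} {W W' A C E F : Set V}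

/-- The vertex boundary of `A`: the vertices outside `A` with a neighbor in `A`. -/
def vertexBoundary (G : SimpleGraph V) (A : Set V) : Set V :=
  {x | x ∉ A ∧ ∃ a ∈ A, G.Adj a x}

/-- `F` is the vertex set of a connected component of the subgraph of `G` induced by `W`. -/
def IsComponentIn (G : SimpleGraph V) (W F : Set V) : Prop :=
  Maximal (fun A => A ⊆ W ∧ (G.induce A).Connected) F

theorem vertexBoundary_inter_nonempty (hC : (G.induce C).Connected) (hA : A.Nonempty)
    (hAC : A ⊂ C) : (vertexBoundary G A ∩ C).Nonempty := by
  obtain ⟨a, ha⟩ := hA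
  obtain ⟨c, hc, hcA⟩ := Set.exists_of_ssubset hAC
  obtain ⟨p⟩ := hC.preconnected ⟨a, hAC.subset ha⟩ ⟨c, hc⟩
  obtain ⟨d, -, hfst, hsnd⟩ := p.exists_boundary_dart (Subtype.val ⁻¹' A) ha hcA
  exact ⟨d.snd, ⟨hsnd, d.fst, hfst, d.adj⟩, d.snd.2⟩

theorem connected_induce_singleton (v : V) : (G.induce {v}).Connected :=
  SimpleGraph.IsTree.of_subsingleton.connected

theorem exists_isComponentIn_superset [Finite V] (hA : (G.induce A).Connected) (hAW : A ⊆ W) :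
    ∃ F, IsComponentIn G W F ∧ A ⊆ F := by
  obtain ⟨F, hAF, hF⟩ := Finite.exists_le_maximal
    (p := fun A => A ⊆ W ∧ (G.induce A).Connected) ⟨hAW, hA⟩
  exact ⟨F, hF, hAF⟩

theorem exists_isComponentIn_mem [Finite V] {v : V} (hv : v ∈ W) :
    ∃ F, IsComponentIn G W F ∧ v ∈ F := by
  simpa only [Set.singleton_subset_iff] using
    exists_isComponentIn_superset (connected_induce_singleton v) (Set.singleton_subset_iff.mpr hv)

namespace IsComponentIn

theorem subset (hF : IsComponentIn G W F) : F ⊆ W :=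
  hF.prop.1

theorem connected (hF : IsComponentIn G W F) : (G.induce F).Connected :=
  hF.prop.2

theorem nonempty (hF : IsComponentIn G W F) : F.Nonempty :=
  Set.nonempty_coe_sort.mp hF.connected.nonempty

theorem subset_of_inter_nonempty (hF : IsComponentIn G W F) (hA : (G.induce A).Connected)
    (hAW : A ⊆ W) (hFA : (F ∩ A).Nonempty) : A ⊆ F :=
  Set.union_subset_iff.mp (hF.le_of_ge
    ⟨Set.union_subset hF.subset hAW,
      SimpleGraph.induce_union_connected hF.connected.preconnected hA.preconnected hFA⟩
    Set.subset_union_left) |>.2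

theorem mem_of_adj (hF : IsComponentIn G W F) {x y : V} (hx : x ∈ F) (hy : y ∈ W)
    (hxy : G.Adj x y) : y ∈ F :=
  hF.le_of_ge
    ⟨Set.union_subset hF.subset (Set.singleton_subset_iff.mpr hy),
      SimpleGraph.connected_induce_union hF.connected.preconnected
        (connected_induce_singleton y).preconnected hx rfl hxy⟩
    Set.subset_union_left (Set.mem_union_right F rfl)

theorem eq_of_inter_nonempty (hE : IsComponentIn G W E) (hF : IsComponentIn G W F)
    (hEF : (E ∩ F).Nonempty) : E = F :=
  (hF.subset_of_inter_nonempty hE.connected hE.subset (Set.inter_comm E F ▸ hEF)).antisymm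
    (hE.subset_of_inter_nonempty hF.connected hF.subset hEF)

theorem anti (hF : IsComponentIn G W F) (hFW' : F ⊆ W') (hW' : W' ⊆ W) : IsComponentIn G W' F :=
  ⟨⟨hFW', hF.connected⟩, fun _ hA hFA => hF.le_of_ge ⟨hA.1.trans hW', hA.2⟩ hFA⟩

theorem vertexBoundary_subset_compl (hF : IsComponentIn G W F) : vertexBoundary G F ⊆ Wᶜ :=
  fun _ ⟨hxF, _, ha, hax⟩ hxW => hxF (hF.mem_of_adj ha hxW hax)

theorem diff_vertexBoundary (hE : (G.induce E).Connected) (hEC : E ⊆ C) :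
    IsComponentIn G (C \ vertexBoundary G E) E := by
  refine ⟨⟨fun x hx => ⟨hEC hx, fun hx' => hx'.1 hx⟩, hE⟩, fun A ⟨hA, hAconn⟩ hEA => ?_⟩
  by_contra hAE
  obtain ⟨x, hxE, hxA⟩ := vertexBoundary_inter_nonempty hAconn
    (Set.nonempty_coe_sort.mp hE.nonempty) ⟨hEA, hAE⟩
  exact (hA hxA).2 hxE

end IsComponentIn

theorem vertexBoundary_subset_of_isComponentIn_diff {X : Set V} (hF : IsComponentIn G (C \ X) F) :
    vertexBoundary G F ⊆ vertexBoundary G C ∪ X := by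
  intro x hx
  by_cases hxC : x ∈ C
  · by_contra hxX
    exact hF.vertexBoundary_subset_compl hx ⟨hxC, fun h => hxX (Or.inr h)⟩
  · obtain ⟨-, a, ha, hax⟩ := hx
    exact Or.inl ⟨hxC, a, (hF.subset ha).1, hax⟩

theorem isComponentIn_diff_or_of_isComponentIn_diff [Finite V] {X : Set V}
    (hC : IsComponentIn G W C) (hXC : X ⊆ C) (hF : IsComponentIn G (W \ X) F) :
    IsComponentIn G (C \ X) F ∨ IsComponentIn G W F := by
  obtain ⟨E, hE, hFE⟩ := exists_isComponentIn_superset hF.connected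
    (hF.subset.trans Set.sdiff_subset)
  by_cases hEC : E = C
  · exact Or.inl (hF.anti (fun x hx => ⟨hEC ▸ hFE hx, (hF.subset hx).2⟩)
      (Set.sdiff_subset_sdiff_left hC.subset))
  · have hEX : E ⊆ W \ X := fun x hx =>
      ⟨hE.subset hx, fun hxX => hEC (hE.eq_of_inter_nonempty hC ⟨x, hx, hXC hxX⟩)⟩
    exact Or.inr (hFE.antisymm (hF.le_of_ge ⟨hEX, hE.connected⟩ hFE) ▸ hE)

end Components

section Gluing

open scoped SimpleGraph

theorem isTree_sum_sup_edge {M N : Type*} [Finite M] [Finite N] {S : SimpleGraph M}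
    {T : SimpleGraph N} (hS : S.IsTree) (hT : T.IsTree) (s : M) (t : N) :
    ((S ⊕g T) ⊔ SimpleGraph.edge (.inl s) (.inr t)).IsTree := by
  refine SimpleGraph.isTree_iff_connected_and_card.mpr
    ⟨hS.connected.sum_sup_edge hT.connected, ?_⟩
  have hnew : s(.inl s, .inr t) ∉ (S ⊕g T).edgeSet := 
    SimpleGraph.not_adj_sum_inl_inr (G := S) (H := T) s t
  have hcardS := (SimpleGraph.isTree_iff_connected_and_card.mp hS).2
  have hcardT := (SimpleGraph.isTree_iff_connected_and_card.mp hT).2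
  rw [SimpleGraph.edgeSet_sup, SimpleGraph.edgeSet_edge_of_ne Sum.inl_ne_inr, Set.union_singleton,
    Nat.card_coe_set_eq, Set.ncard_insert_of_notMem hnew, ← Nat.card_coe_set_eq,
    Nat.card_congr SimpleGraph.edgeSetSumEquiv, Nat.card_sum, Nat.card_sum]
  omega

theorem connected_induce_image {M N : Type*} {S : SimpleGraph M} {T : SimpleGraph N} {I : Set M}
    (hI : (S.induce I).Connected) (f : S →g T) : (T.induce (f '' I)).Connected :=
  hI.map (SimpleGraph.induceHom f (Set.mapsTo_image f I)) (Set.surjective_mapsTo_image_restrict f I)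

variable {V M N : Type*} {G : SimpleGraph V} {S : SimpleGraph M} {T : SimpleGraph N}
  {bagS : M → Set V} {bagT : N → Set V} {U U' : Set V}

/-- `T` with the bags `bag` is a tree decomposition of the subgraph of `G` induced by `U`. Bags are
sets of vertices of `G`, so that decompositions of different subgraphs can be glued. That every
vertex lies in a bag is part of `connected`, as connected graphs are nonempty. -/
structure IsTreeDecompositionOn (G : SimpleGraph V) (T : SimpleGraph N) (bag : N → Set V)
    (U : Set V) : Prop where
  isTree : T.IsTree
  bag_subset : ∀ t, bag t ⊆ U
  edge_mem : ∀ u ∈ U, ∀ v ∈ U, G.Adj u v → ∃ t, u ∈ bag t ∧ v ∈ bag t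
  connected : ∀ v ∈ U, (T.induce {t | v ∈ bag t}).Connected

theorem isTreeDecompositionOn_single (G : SimpleGraph V) (U : Set V) :
    IsTreeDecompositionOn G (⊥ : SimpleGraph Unit) (fun _ => U) U where
  isTree := SimpleGraph.IsTree.of_subsingleton
  bag_subset _ := subset_rfl
  edge_mem _ hu _ hv _ := ⟨(), hu, hv⟩
  connected _ hv :=
    have : Nonempty {_t : Unit | _ ∈ U} := ⟨⟨(), hv⟩⟩
    SimpleGraph.IsTree.of_subsingleton.connected

namespace IsTreeDecompositionOn

theorem setOf_mem_bag_eq_empty (hS : IsTreeDecompositionOn G S bagS U) {v : V} (hv : v ∉ U) :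
    {t | v ∈ bagS t} = ∅ :=
  Set.eq_empty_of_forall_notMem fun t ht => hv (hS.bag_subset t ht)

theorem connected_glue (hS : IsTreeDecompositionOn G S bagS U)
    (hT : IsTreeDecompositionOn G T bagT U') {s : M} {t : N} (hs : U ∩ U' ⊆ bagS s)
    (ht : U ∩ U' ⊆ bagT t) {v : V} (hv : v ∈ U ∪ U') :
    (((S ⊕g T) ⊔ SimpleGraph.edge (.inl s) (.inr t)).induce
      {i | v ∈ Sum.elim bagS bagT i}).Connected := by
  set R := (S ⊕g T) ⊔ SimpleGraph.edge (.inl s) (.inr t)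
  let inl : S →g R := (SimpleGraph.Hom.ofLE le_sup_left).comp SimpleGraph.Embedding.sumInl.toHom
  let inr : T →g R := (SimpleGraph.Hom.ofLE le_sup_left).comp SimpleGraph.Embedding.sumInr.toHom
  have hst : R.Adj (inl s) (inr t) :=
    Or.inr ((SimpleGraph.edge_adj ..).mpr ⟨Or.inl ⟨rfl, rfl⟩, Sum.inl_ne_inr⟩)
  have hsplit : {i | v ∈ Sum.elim bagS bagT i} =
      inl '' {i | v ∈ bagS i} ∪ inr '' {i | v ∈ bagT i} := by
    rw [Set.ext_iff, Sum.forall]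
    simp [inl, inr]
  rw [hsplit]
  by_cases hvU : v ∈ U
  · by_cases hvU' : v ∈ U'
    · exact SimpleGraph.connected_induce_union
        (connected_induce_image (hS.connected v hvU) inl).preconnected
        (connected_induce_image (hT.connected v hvU') inr).preconnected
        (Set.mem_image_of_mem inl (hs ⟨hvU, hvU'⟩)) (Set.mem_image_of_mem inr (ht ⟨hvU, hvU'⟩)) hst
    · rw [hT.setOf_mem_bag_eq_empty hvU', Set.image_empty, Set.union_empty]
      exact connected_induce_image (hS.connected v hvU) inl
  · rw [hS.setOf_mem_bag_eq_empty hvU, Set.image_empty, Set.empty_union]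
    exact connected_induce_image (hT.connected v (hv.resolve_left hvU)) inr

theorem glue [Finite M] [Finite N] (hS : IsTreeDecompositionOn G S bagS U)
    (hT : IsTreeDecompositionOn G T bagT U') {s : M} {t : N} (hs : U ∩ U' ⊆ bagS s)
    (ht : U ∩ U' ⊆ bagT t) (hG : ∀ u ∈ U, ∀ v ∈ U', G.Adj u v → v ∈ U ∨ u ∈ U') :
    IsTreeDecompositionOn G ((S ⊕g T) ⊔ SimpleGraph.edge (.inl s) (.inr t)) (Sum.elim bagS bagT)
      (U ∪ U') where
  isTree := isTree_sum_sup_edge hS.isTree hT.isTree s t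
  bag_subset := Sum.forall.mpr
    ⟨fun i => (hS.bag_subset i).trans Set.subset_union_left,
      fun j => (hT.bag_subset j).trans Set.subset_union_right⟩
  edge_mem u hu v hv huv := by
    have hcase : u ∈ U ∧ v ∈ U ∨ u ∈ U' ∧ v ∈ U' := by
      rcases hu with hu | hu <;> rcases hv with hv | hv
      · exact Or.inl ⟨hu, hv⟩
      · exact (hG u hu v hv huv).imp (⟨hu, ·⟩) (⟨·, hv⟩)
      · exact (hG v hv u hu huv.symm).imp (⟨·, hv⟩) (⟨hu, ·⟩)
      · exact Or.inr ⟨hu, hv⟩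
    exact Sum.exists.mpr (hcase.imp (fun h => hS.edge_mem u h.1 v h.2 huv)
      fun h => hT.edge_mem u h.1 v h.2 huv)
  connected _ hv := hS.connected_glue hT hs ht hv

end IsTreeDecompositionOn

theorem IsTreeDecompositionOn.treewidth_le {V : Type u} [Finite V] {G : SimpleGraph V} {N : Type}
    [Finite N] {T : SimpleGraph N} {bag : N → Set V} (hT : IsTreeDecompositionOn G T bag Set.univ)
    {m : ℕ} (hm : ∀ t, (bag t).ncard ≤ m) : treewidth G ≤ m - 1 := by
  classical
  cases nonempty_fintype V
  cases nonempty_fintype N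
  let D : TreeDecomposition G :=
    { Node := N
      tree := T
      isTree := hT.isTree
      bag := fun t => (bag t).toFinset
      vertex_mem := fun v =>
        have ⟨t, ht⟩ := (hT.connected v (Set.mem_univ v)).nonempty
        ⟨t, Set.mem_toFinset.mpr ht⟩
      edge_mem := fun u v huv => by
        simpa only [Set.mem_toFinset] using hT.edge_mem u (Set.mem_univ u) v (Set.mem_univ v) huv
      connected := fun v => by
        rw [show {t | v ∈ (bag t).toFinset} = {t | v ∈ bag t} from
          Set.ext fun _ => Set.mem_toFinset]
        exact hT.connected v (Set.mem_univ v) }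
  have hD : D.width ≤ m - 1 := Nat.sub_le_sub_right
    (Finset.sup_le fun t _ => (Set.ncard_eq_toFinset_card' (bag t)).symm.trans_le (hm t)) 1
  exact ((treewidth_isLeast G).2 ⟨D, rfl⟩).trans hD

end Gluing

section Exploration

variable {V : Type*} {G : SimpleGraph V} {good : Set V → Prop} {m : ℕ} {C U : Set V}

/-- One step of an exploration of `G`: some nonempty `X ⊆ C` can be added to the explored part,
through a bag of size at most `m` consisting of `X` and the boundary of `C`, so that all components
left over from `C` are `good`. -/
def IsExplorable (G : SimpleGraph V) (good : Set V → Prop) (m : ℕ) (C : Set V) : Prop :=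
  ∃ X ⊆ C, X.Nonempty ∧ (vertexBoundary G C ∪ X).ncard ≤ m ∧
    ∀ F, IsComponentIn G (C \ X) F → good F

/-- A state of an exploration of `G`: the subgraph induced by the explored part `U` has a tree
decomposition with bags of size at most `m`, and all components of the unexplored part are `good`
and have their boundary inside some bag, to which the tree can be extended. -/
def IsExplored (G : SimpleGraph V) (good : Set V → Prop) (m : ℕ) (U : Set V) : Prop :=
  ∃ (N : Type) (_ : Finite N) (T : SimpleGraph N) (bag : N → Set V),
    IsTreeDecompositionOn G T bag U ∧ (∀ t, (bag t).ncard ≤ m) ∧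
      ∀ F, IsComponentIn G Uᶜ F → good F ∧ ∃ t, vertexBoundary G F ⊆ bag t

theorem isExplored_empty (hgood : ∀ F, IsComponentIn G Set.univ F → good F) :
    IsExplored G good m ∅ := by
  refine ⟨Unit, inferInstance, ⊥, fun _ => ∅, isTreeDecompositionOn_single G ∅, by simp, ?_⟩
  rw [Set.compl_empty]
  exact fun F hF => ⟨hgood F hF, (), by simpa using hF.vertexBoundary_subset_compl⟩

theorem IsExplored.exists_ssuperset [Finite V] (hU : IsExplored G good m U) (hne : U ≠ Set.univ)
    (hstep : ∀ C, (G.induce C).Connected → good C → IsExplorable G good m C) :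
    ∃ U', U ⊂ U' ∧ IsExplored G good m U' := by
  obtain ⟨N, _, T, bag, hT, hbag, hcomp⟩ := hU
  obtain ⟨v, hv⟩ := (Set.ne_univ_iff_exists_notMem U).mp hne
  obtain ⟨C, hC, -⟩ := exists_isComponentIn_mem (G := G) (W := Uᶜ) hv
  obtain ⟨hgood, t, ht⟩ := hcomp C hC
  obtain ⟨X, hXC, ⟨x, hx⟩, hcard, hX⟩ := hstep C hC.connected hgood
  have hbdry : vertexBoundary G C ⊆ U := hC.vertexBoundary_subset_compl.trans (compl_compl U).subset
  have hinter : U ∩ (vertexBoundary G C ∪ X) ⊆ vertexBoundary G C := fun y ⟨hyU, hy⟩ =>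
    hy.resolve_right fun hyX => hC.subset (hXC hyX) hyU
  have hunion : U ∪ (vertexBoundary G C ∪ X) = U ∪ X := by
    rw [← Set.union_assoc, Set.union_eq_left.mpr hbdry]
  have hedge : ∀ u ∈ U, ∀ w ∈ vertexBoundary G C ∪ X, G.Adj u w →
      w ∈ U ∨ u ∈ vertexBoundary G C ∪ X := fun u hu w hw huw =>
    hw.imp (@hbdry w) fun hwX => Or.inl ⟨fun huC => hC.subset huC hu, w, hXC hwX, huw.symm⟩
  have hglue := hT.glue (isTreeDecompositionOn_single G (vertexBoundary G C ∪ X)) (t := ())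
    (hinter.trans ht) Set.inter_subset_right hedge
  rw [hunion] at hglue
  refine ⟨U ∪ X, ⟨Set.subset_union_left, fun h => hC.subset (hXC hx) (h (Or.inr hx))⟩,
    N ⊕ Unit, inferInstance, _, _, hglue, Sum.forall.mpr ⟨hbag, fun _ => hcard⟩, fun F hF => ?_⟩
  rw [Set.compl_union, ← Set.sdiff_eq] at hF
  rcases isComponentIn_diff_or_of_isComponentIn_diff hC hXC hF with hF | hF
  · exact ⟨hX F hF, .inr (), vertexBoundary_subset_of_isComponentIn_diff hF⟩
  · obtain ⟨hFgood, s, hs⟩ := hcomp F hF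
    exact ⟨hFgood, .inl s, hs⟩

theorem treewidth_le_of_forall_isExplorable {V : Type u} [Finite V] {G : SimpleGraph V}
    {good : Set V → Prop} {m : ℕ} (hstart : ∀ F, IsComponentIn G Set.univ F → good F)
    (hstep : ∀ C, (G.induce C).Connected → good C → IsExplorable G good m C) :
    treewidth G ≤ m - 1 := by
  obtain ⟨U, -, hU⟩ := Finite.exists_le_maximal (isExplored_empty (m := m) hstart)
  have huniv : U = Set.univ := by
    by_contra hne
    obtain ⟨U', hUU', hU'⟩ := hU.prop.exists_ssuperset hne hstep
    exact hUU'.not_subset (hU.le_of_ge hU' hUU'.subset)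
  obtain ⟨N, _, T, bag, hT, hbag, -⟩ := hU.prop
  exact (huniv ▸ hT).treewidth_le hbag

end Exploration

section Orientation

variable {V : Type*} {G : SimpleGraph V} {D : Digraph V} {C E F K L : Set V} {y : V}

/-- The non-neighbors in `C` of a vertex `y`, which may lie inside or outside `C`. -/
def nonNeighborsIn (G : SimpleGraph V) (C : Set V) (y : V) : Set V :=
  {x ∈ C | x ≠ y ∧ ¬G.Adj y x}

theorem exists_isComponentIn_forall_adj [Finite V] {y₀ c : V} (hy₀ : y₀ ∈ vertexBoundary G C)
    (hc : c ∈ C) (hnadj : ¬G.Adj y₀ c) :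
    ∃ y ∈ vertexBoundary G C, ∃ E, IsComponentIn G (nonNeighborsIn G C y) E ∧
      ∀ z ∈ vertexBoundary G C \ vertexBoundary G E, ∀ t ∈ vertexBoundary G E ∩ C, G.Adj z t := by
  have hmem {z x : V} (hz : z ∈ vertexBoundary G C) (hx : x ∈ C) (hzx : ¬G.Adj z x) :
      x ∈ nonNeighborsIn G C z :=
    ⟨hx, ne_of_mem_of_not_mem hx hz.1, hzx⟩
  obtain ⟨E₀, hE₀, -⟩ := exists_isComponentIn_mem (G := G) (hmem hy₀ hc hnadj)
  obtain ⟨E, -, ⟨y, hy, hE⟩, hmax⟩ := Finite.exists_le_maximal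
    (p := fun E => ∃ y ∈ vertexBoundary G C, IsComponentIn G (nonNeighborsIn G C y) E)
    ⟨y₀, hy₀, hE₀⟩
  refine ⟨y, hy, E, hE, fun z ⟨hz, hzE⟩ t ⟨⟨htE, e, he, het⟩, htC⟩ => ?_⟩
  by_contra hzt
  have hsub : E ∪ {t} ⊆ nonNeighborsIn G C z := by
    refine Set.union_subset (fun x hx => ?_) (Set.singleton_subset_iff.mpr (hmem hz htC hzt))
    have hxC : x ∈ C := (hE.subset hx).1
    exact hmem hz hxC fun hzx => hzE ⟨fun h => hz.1 (hE.subset h).1, x, hx, hzx.symm⟩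
  have hconn := SimpleGraph.connected_induce_union hE.connected.preconnected
    (connected_induce_singleton t).preconnected he rfl het
  obtain ⟨E', hE', hEE'⟩ := exists_isComponentIn_superset hconn hsub
  exact htE (hmax ⟨z, hz, hE'⟩ (Set.subset_union_left.trans hEE') (hEE' (Or.inr rfl)))

theorem ncard_le_cliqueNum [Finite V] (hC : G.IsClique C) : C.ncard ≤ G.cliqueNum := by
  classical
  cases nonempty_fintype V
  rw [Set.ncard_eq_toFinset_card']
  exact SimpleGraph.IsClique.card_le_cliqueNum (tc := by rwa [Set.coe_toFinset])

/-- `D` orients the edges of `G` so that all out-neighborhoods are cliques of `G`. For the upper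
bound on the treewidth, edges may receive both directions. -/
structure IsCliqueOrientation (D : Digraph V) (G : SimpleGraph V) : Prop where
  adj_iff : ∀ u v, G.Adj u v ↔ D.Adj u v ∨ D.Adj v u
  isClique : ∀ v, G.IsClique {w | D.Adj v w}

/-- The vertices outside `F` that send an arc into `F`. -/
def inBoundary (D : Digraph V) (F : Set V) : Set V :=
  {x | x ∉ F ∧ ∃ f ∈ F, D.Adj x f}

/-- `K` is a subset of `F` closed under following arcs inside `F`. -/
def IsOutClosedIn (D : Digraph V) (F K : Set V) : Prop :=
  K ⊆ F ∧ ∀ k ∈ K, ∀ g ∈ F, D.Adj k g → g ∈ K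

theorem isOutClosedIn_sUnion {𝒦 : Set (Set V)} (h : ∀ K ∈ 𝒦, IsOutClosedIn D F K) :
    IsOutClosedIn D F (⋃₀ 𝒦) :=
  ⟨Set.sUnion_subset fun K hK => (h K hK).1, fun k ⟨K, hK, hkK⟩ g hg hkg =>
    ⟨K, hK, (h K hK).2 k hkK g hg hkg⟩⟩

namespace IsCliqueOrientation

theorem adj (hD : IsCliqueOrientation D G) {u v : V} (h : D.Adj u v) : G.Adj u v :=
  (hD.adj_iff u v).mpr (Or.inl h)

theorem arc_of_adj_of_arc (hD : IsCliqueOrientation D G) {e p : V} (hyp : G.Adj y p)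
    (hpe : D.Adj p e) (hye : y ≠ e) (hnadj : ¬G.Adj y e) : D.Adj y p :=
  ((hD.adj_iff y p).mp hyp).resolve_right fun hpy => hnadj (hD.isClique p hpy hpe hye)

theorem inBoundary_subset_vertexBoundary (hD : IsCliqueOrientation D G) :
    inBoundary D F ⊆ vertexBoundary G F :=
  fun _ ⟨hxF, f, hf, hxf⟩ => ⟨hxF, f, hf, (hD.adj hxf).symm⟩

theorem arc_of_isOutClosedIn (hD : IsCliqueOrientation D G) (hK : IsOutClosedIn D F K) {k v : V}
    (hk : k ∈ K) (hv : v ∈ F \ K) (hkv : G.Adj k v) : D.Adj v k :=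
  ((hD.adj_iff k v).mp hkv).resolve_left fun h => hv.2 (hK.2 k hk v hv.1 h)

theorem isOutClosedIn_neighbors_of_disjoint (hD : IsCliqueOrientation D G)
    (hK : IsOutClosedIn D F K) (hL : IsOutClosedIn D F L) (hKL : Disjoint K L) :
    IsOutClosedIn D F {v ∈ F \ L | v ∈ K ∨ ∃ k ∈ K, G.Adj k v} := by
  refine ⟨fun v hv => hv.1.1, fun v ⟨⟨hvF, _⟩, hv⟩ g hg hvg => ?_⟩
  by_cases hgK : g ∈ K
  · exact ⟨⟨hg, Set.disjoint_left.mp hKL hgK⟩, Or.inl hgK⟩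
  have hvK : v ∉ K := fun hvK => hgK (hK.2 v hvK g hg hvg)
  obtain ⟨k, hk, hkv⟩ := hv.resolve_left hvK
  have hvk : D.Adj v k := hD.arc_of_isOutClosedIn hK hk ⟨hvF, hvK⟩ hkv
  have hkg : G.Adj k g := hD.isClique v hvk hvg (ne_of_mem_of_not_mem hk hgK)
  have hgk : D.Adj g k := hD.arc_of_isOutClosedIn hK hk ⟨hg, hgK⟩ hkg
  have hgL : g ∉ L := fun hgL => Set.disjoint_left.mp hKL hk (hL.2 g hgL k (hK.1 hk) hgk)
  exact ⟨⟨hg, hgL⟩, Or.inr ⟨k, hk, hkg⟩⟩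

theorem inter_nonempty_of_isOutClosedIn (hD : IsCliqueOrientation D G)
    (hF : (G.induce F).Connected) (hK : IsOutClosedIn D F K) (hL : IsOutClosedIn D F L)
    (hKne : K.Nonempty) (hLne : L.Nonempty) : (K ∩ L).Nonempty := by
  by_contra hKL
  -- The largest out-closed set disjoint from `L` could be enlarged by its neighbors outside `L`.
  set M := ⋃₀ {A | IsOutClosedIn D F A ∧ Disjoint A L}
  have hM : IsOutClosedIn D F M := isOutClosedIn_sUnion fun A hA => hA.1
  have hML : Disjoint M L := Set.disjoint_sUnion_left.mpr fun A hA => hA.2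
  have hMne : M.Nonempty := hKne.mono <| Set.subset_sUnion_of_mem
    ⟨hK, Set.disjoint_iff_inter_eq_empty.mpr (Set.not_nonempty_iff_eq_empty.mp hKL)⟩
  have hMF : M ⊂ F := hM.1.ssubset_of_ne fun h => by
    obtain ⟨l, hl⟩ := hLne
    exact Set.disjoint_left.mp hML (h ▸ hL.1 hl) hl
  obtain ⟨v, ⟨hvM, k, hk, hkv⟩, hvF⟩ := vertexBoundary_inter_nonempty hF hMne hMF
  have hvk : D.Adj v k := hD.arc_of_isOutClosedIn hM hk ⟨hvF, hvM⟩ hkv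
  have hvL : v ∉ L := fun hvL => Set.disjoint_left.mp hML hk (hL.2 v hvL k (hM.1 hk) hvk)
  exact hvM ⟨_, ⟨hD.isOutClosedIn_neighbors_of_disjoint hM hL hML,
    Set.disjoint_left.mpr fun w hw => hw.1.2⟩, ⟨hvF, hvL⟩, Or.inr ⟨k, hk, hkv⟩⟩

theorem isClique_vertexBoundary_diff_inBoundary (hD : IsCliqueOrientation D G)
    (hF : (G.induce F).Connected) : G.IsClique (vertexBoundary G F \ inBoundary D F) := by
  have harc {x f : V} (hx : x ∈ vertexBoundary G F \ inBoundary D F) (hf : f ∈ F)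
      (hfx : G.Adj f x) : D.Adj f x :=
    ((hD.adj_iff f x).mp hfx).resolve_right fun h => hx.2 ⟨hx.1.1, f, hf, h⟩
  have hclosed {x : V} (hx : x ∈ vertexBoundary G F \ inBoundary D F) :
      IsOutClosedIn D F {f ∈ F | G.Adj f x} :=
    ⟨fun _ hf => hf.1, fun k ⟨hk, hkx⟩ g hg hkg =>
      ⟨hg, hD.isClique k hkg (harc hx hk hkx) (ne_of_mem_of_not_mem hg hx.1.1)⟩⟩
  intro x hx z hz hxz
  obtain ⟨f, ⟨hf, hfx⟩, -, hfz⟩ := hD.inter_nonempty_of_isOutClosedIn hF (hclosed hx) (hclosed hz)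
    hx.1.2 hz.1.2
  exact hD.isClique f (harc hx hf hfx) (harc hz hf hfz) hxz

theorem ncard_vertexBoundary_inter_le [Finite V] (hD : IsCliqueOrientation D G)
    (hF : (G.induce F).Connected) {Y : Set V} (hin : G.IsClique (inBoundary D F ∩ Y)) :
    (vertexBoundary G F ∩ Y).ncard ≤ 2 * G.cliqueNum := by
  have hcover : vertexBoundary G F ∩ Y ⊆
      (vertexBoundary G F \ inBoundary D F) ∪ (inBoundary D F ∩ Y) := fun x ⟨hx, hxY⟩ =>
    or_iff_not_imp_right.mpr fun h => ⟨hx, fun hx' => h ⟨hx', hxY⟩⟩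
  have houtCard := ncard_le_cliqueNum (hD.isClique_vertexBoundary_diff_inBoundary hF)
  have hinCard := ncard_le_cliqueNum hin
  calc (vertexBoundary G F ∩ Y).ncard
      ≤ _ := Set.ncard_le_ncard hcover
    _ ≤ _ := Set.ncard_union_le _ _
    _ ≤ 2 * G.cliqueNum := by omega

theorem isClique_inBoundary_of_ne (hD : IsCliqueOrientation D G)
    (hin : G.IsClique (inBoundary D C)) (hE : (G.induce E).Connected) (hEC : E ⊆ C)
    (hfull : ∀ z ∈ vertexBoundary G C \ vertexBoundary G E,
      ∀ t ∈ vertexBoundary G E ∩ C, G.Adj z t)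
    (hF : IsComponentIn G (C \ vertexBoundary G E) F) (hFE : F ≠ E) :
    G.IsClique (inBoundary D F) := by
  have hE' := IsComponentIn.diff_vertexBoundary hE hEC
  have hnoArc {x : V} (hx : x ∈ inBoundary D F) : x ∉ inBoundary D E := fun ⟨_, e, he, hxe⟩ => by
    obtain ⟨-, f, hf, hxf⟩ := hx
    have hfE : f ∉ E := fun h => hFE (hF.eq_of_inter_nonempty hE' ⟨f, hf, h⟩)
    exact hfE (hE'.mem_of_adj he (hF.subset hf)
      (hD.isClique x hxe hxf (ne_of_mem_of_not_mem he hfE)))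
  have hinside {x : V} (hx : x ∈ inBoundary D F) (hxC : x ∈ C) : x ∈ vertexBoundary G E := by
    by_contra hxE
    exact hF.vertexBoundary_subset_compl (hD.inBoundary_subset_vertexBoundary hx) ⟨hxC, hxE⟩
  have houtside {x : V} (hx : x ∈ inBoundary D F) (hxC : x ∉ C) : x ∈ inBoundary D C :=
    have ⟨_, f, hf, hxf⟩ := hx
    ⟨hxC, f, (hF.subset hf).1, hxf⟩
  have hEclique := hD.isClique_vertexBoundary_diff_inBoundary hE
  have hmixed {x z : V} (hx : x ∈ inBoundary D F) (hz : z ∈ inBoundary D F) (hxC : x ∈ C)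
      (hzC : z ∉ C) : G.Adj z x := by
    by_cases hzE : z ∈ vertexBoundary G E
    · exact hEclique ⟨hzE, hnoArc hz⟩ ⟨hinside hx hxC, hnoArc hx⟩
        (ne_of_mem_of_not_mem hxC hzC).symm
    · exact hfull z ⟨hD.inBoundary_subset_vertexBoundary (houtside hz hzC), hzE⟩ x
        ⟨hinside hx hxC, hxC⟩
  intro p hp q hq hpq
  by_cases hpC : p ∈ C <;> by_cases hqC : q ∈ C
  · exact hEclique ⟨hinside hp hpC, hnoArc hp⟩ ⟨hinside hq hqC, hnoArc hq⟩ hpq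
  · exact (hmixed hp hq hpC hqC).symm
  · exact hmixed hq hp hqC hpC
  · exact hin (houtside hp hpC) (houtside hq hqC) hpq

theorem inBoundary_inter_subset (hD : IsCliqueOrientation D G)
    (hE : IsComponentIn G (nonNeighborsIn G C y) E) :
    inBoundary D E ∩ C ⊆ {w | D.Adj y w} := by
  intro q ⟨⟨hqE, e, he, hqe⟩, hqC⟩
  obtain ⟨-, hey, hnadj⟩ := hE.subset he
  have hyq : G.Adj y q := by
    by_contra hyq
    have hqy : q ≠ y := fun hqy => hnadj (hqy ▸ hD.adj hqe)
    exact hqE (hE.mem_of_adj he ⟨hqC, hqy, hyq⟩ (hD.adj hqe).symm)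
  exact hD.arc_of_adj_of_arc hyq hqe hey.symm hnadj

theorem isClique_inBoundary (hD : IsCliqueOrientation D G) (hin : G.IsClique (inBoundary D C))
    (hE : IsComponentIn G (nonNeighborsIn G C y) E)
    (hy : (∃ p ∈ C, D.Adj y p) → ∀ q ∈ inBoundary D C, q ≠ y → G.Adj y q) :
    G.IsClique (inBoundary D E) := by
  have houtside {q : V} (hq : q ∈ inBoundary D E) (hqC : q ∉ C) : q ∈ inBoundary D C :=
    have ⟨_, e, he, hqe⟩ := hq
    ⟨hqC, e, (hE.subset he).1, hqe⟩
  by_cases hinside : ∃ p ∈ inBoundary D E, p ∈ C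
  · obtain ⟨p, hp, hpC⟩ := hinside
    refine (hD.isClique y).subset fun q hq => ?_
    by_cases hqC : q ∈ C
    · exact hD.inBoundary_inter_subset hE ⟨hq, hqC⟩
    obtain ⟨-, e, he, hqe⟩ := id hq
    obtain ⟨-, hey, hnadj⟩ := hE.subset he
    have hqy : q ≠ y := fun hqy => hnadj (hqy ▸ hD.adj hqe)
    have hyq : G.Adj y q := hy ⟨p, hpC, hD.inBoundary_inter_subset hE ⟨hp, hpC⟩⟩ q
      (houtside hq hqC) hqy
    exact hD.arc_of_adj_of_arc hyq hqe hey.symm hnadj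
  · exact hin.subset fun q hq => houtside hq fun hqC => hinside ⟨q, hq, hqC⟩

section Finite

variable [Finite V]

theorem isExplorable_of_isClique (hD : IsCliqueOrientation D G) (hC : (G.induce C).Connected)
    (hin : G.IsClique (inBoundary D C)) (hclique : G.IsClique C) {good : Set V → Prop} :
    IsExplorable G good (4 * G.cliqueNum) C := by
  refine ⟨C, subset_rfl, Set.nonempty_coe_sort.mp hC.nonempty, ?_, fun F hF => ?_⟩
  · have hbdry := hD.ncard_vertexBoundary_inter_le hC (Y := Set.univ) (by rwa [Set.inter_univ])
    rw [Set.inter_univ] at hbdry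
    have hcard := ncard_le_cliqueNum hclique
    exact (Set.ncard_union_le _ _).trans (by omega)
  · obtain ⟨x, hx⟩ := hF.nonempty
    exact absurd (hF.subset hx).1 (hF.subset hx).2

theorem isExplorable_of_isComponentIn (hD : IsCliqueOrientation D G)
    (hC : (G.induce C).Connected) (hin : G.IsClique (inBoundary D C))
    (hyC : y ∈ C ∪ vertexBoundary G C) (hE : IsComponentIn G (nonNeighborsIn G C y) E)
    (hy : (∃ p ∈ C, D.Adj y p) → ∀ q ∈ inBoundary D C, q ≠ y → G.Adj y q)
    (hfull : ∀ z ∈ vertexBoundary G C \ vertexBoundary G E,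
      ∀ t ∈ vertexBoundary G E ∩ C, G.Adj z t) :
    IsExplorable G (fun F => G.IsClique (inBoundary D F)) (4 * G.cliqueNum) C := by
  have hEC : E ⊂ C := by
    have hsub : E ⊆ C := fun x hx => (hE.subset hx).1
    refine hsub.ssubset_of_ne fun h => ?_
    rcases hyC with hyC | ⟨-, c, hc, hcy⟩
    · exact (hE.subset (h ▸ hyC)).2.1 rfl
    · exact (hE.subset (h ▸ hc)).2.2 hcy.symm
  refine ⟨vertexBoundary G E ∩ C, Set.inter_subset_right,
    vertexBoundary_inter_nonempty hC hE.nonempty hEC, ?_, fun F hF => ?_⟩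
  · have hbdryC := hD.ncard_vertexBoundary_inter_le hC (Y := Set.univ) (by rwa [Set.inter_univ])
    rw [Set.inter_univ] at hbdryC
    have hbdryE := hD.ncard_vertexBoundary_inter_le hE.connected
      ((hD.isClique y).subset (hD.inBoundary_inter_subset hE))
    exact (Set.ncard_union_le _ _).trans (by omega)
  · rw [Set.sdiff_inter_self_eq_sdiff] at hF
    by_cases hFE : F = E
    · exact hFE ▸ hD.isClique_inBoundary hin hE hy
    · exact hD.isClique_inBoundary_of_ne hin hE.connected hEC.subset hfull hF hFE

theorem isExplorable (hD : IsCliqueOrientation D G) (hC : (G.induce C).Connected)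
    (hin : G.IsClique (inBoundary D C)) :
    IsExplorable G (fun F => G.IsClique (inBoundary D F)) (4 * G.cliqueNum) C := by
  by_cases hcomplete : ∀ y ∈ vertexBoundary G C, ∀ c ∈ C, G.Adj y c
  · by_cases hclique : G.IsClique C
    · exact hD.isExplorable_of_isClique hC hin hclique
    simp only [SimpleGraph.isClique_iff, Set.Pairwise] at hclique
    push Not at hclique
    obtain ⟨u, hu, v, hv, huv, hnadj⟩ := hclique
    obtain ⟨E, hE, -⟩ := exists_isComponentIn_mem (G := G) (W := nonNeighborsIn G C u)
      ⟨hv, huv.symm, hnadj⟩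
    exact hD.isExplorable_of_isComponentIn hC hin (Or.inl hu) hE
      (fun _ q hq _ => (hcomplete q (hD.inBoundary_subset_vertexBoundary hq) u hu).symm)
      fun z hz t ht => hcomplete z hz.1 t ht.2
  · push Not at hcomplete
    obtain ⟨y₀, hy₀, c, hc, hnadj⟩ := hcomplete
    obtain ⟨y, hy, E, hE, hfull⟩ := exists_isComponentIn_forall_adj hy₀ hc hnadj
    exact hD.isExplorable_of_isComponentIn hC hin (Or.inr hy) hE
      (fun ⟨p, hp, hyp⟩ q hq hqy => hin ⟨hy.1, p, hp, hyp⟩ hq hqy.symm) hfull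

end Finite

theorem treewidth_le {V : Type u} [Finite V] {G : SimpleGraph V} {D : Digraph V}
    (hD : IsCliqueOrientation D G) : treewidth G ≤ 4 * G.cliqueNum - 1 := by
  refine treewidth_le_of_forall_isExplorable (fun F hF => ?_) fun C => hD.isExplorable
  rw [Set.subset_empty_iff.mp <| hD.inBoundary_subset_vertexBoundary.trans <|
    hF.vertexBoundary_subset_compl.trans Set.compl_univ.subset]
  exact SimpleGraph.isClique_empty

end IsCliqueOrientation

theorem IsOnePerfectlyOrientable.induce {V : Type u} {G : SimpleGraph V}
    (hG : IsOnePerfectlyOrientable G) (s : Set V) : IsOnePerfectlyOrientable (G.induce s) := by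
  obtain ⟨D, hD, hclique⟩ := hG
  exact ⟨⟨fun u v => D.Adj u v⟩, ⟨fun u v => hD.adj_iff u v, fun u v => hD.asymm u v⟩,
    fun v x hx z hz hxz => hclique v hx hz fun h => hxz (Subtype.ext h)⟩

theorem IsOnePerfectlyOrientable.treewidth_le {V : Type u} [Finite V] {G : SimpleGraph V}
    (hG : IsOnePerfectlyOrientable G) : treewidth G ≤ 4 * G.cliqueNum - 1 := by
  obtain ⟨D, hD, hclique⟩ := hG
  exact IsCliqueOrientation.treewidth_le ⟨hD.adj_iff, hclique⟩

end Orientation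

section Ramsey

theorem mul_lt_ramseyNumber (k l : ℕ) : k * l < ramseyNumber (k + 1) (l + 1) := by
  by_contra! h
  let G : SimpleGraph (Fin k × Fin l) := SimpleGraph.fromRel fun a b => a.2 = b.2
  have hadj (a b) : G.Adj a b ↔ a ≠ b ∧ a.2 = b.2 := by
    simp [G, SimpleGraph.fromRel_adj, eq_comm (a := b.2)]
  rcases (ramseyNumber_isLeast (k + 1) (l + 1)).1.2 _ G (by simpa using h) with
    ⟨s, hs⟩ | ⟨s, hs⟩
  · have hinj : Set.InjOn Prod.fst (s : Set (Fin k × Fin l)) := by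
      intro a ha b hb hab
      by_contra hne
      exact hne (Prod.ext hab ((hadj a b).mp (hs.isClique ha hb hne)).2)
    have hcard := Finset.card_le_card_of_injOn Prod.fst (fun a _ => Finset.mem_univ a.1) hinj
    rw [hs.card_eq, Finset.card_fin] at hcard
    omega
  · have hinj : Set.InjOn Prod.snd (s : Set (Fin k × Fin l)) := by
      intro a ha b hb hab
      by_contra hne
      exact hs.isIndepSet ha hb hne ((hadj a b).mpr ⟨hne, hab⟩)
    have hcard := Finset.card_le_card_of_injOn Prod.snd (fun a _ => Finset.mem_univ a.2) hinj
    rw [hs.card_eq, Finset.card_fin] at hcard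
    omega

end Ramsey

theorem IsTwOmegaBindingFunction.mono {𝒢 : ∀ {V : Type u}, SimpleGraph V → Prop} {f g : ℕ → ℕ}
    (hf : IsTwOmegaBindingFunction 𝒢 f) (hfg : f ≤ g) : IsTwOmegaBindingFunction 𝒢 g :=
  fun V _ G hG s => (hf V G hG s).trans (hfg _)

theorem mainTheorem8_general :
    IsTwOmegaBindingFunction.{u} IsOnePerfectlyOrientable (fun k => 4 * k - 1) :=
  fun _ _ _ hG s => (hG.induce s).treewidth_le

theorem mainTheorem8 :
    IsTwOmegaBounded.{u} IsOnePerfectlyOrientable ∧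
      IsTwOmegaBindingFunction.{u} IsOnePerfectlyOrientable
        (fun k : ℕ => max k (2 * ramseyNumber (k + 1) 3 - 2) - 1) := by
  have hbinding := mainTheorem8_general.{u}.mono
    (g := fun k => max k (2 * ramseyNumber (k + 1) 3 - 2) - 1) fun k => by
      have hramsey : k * 2 < ramseyNumber (k + 1) 3 := mul_lt_ramseyNumber k 2
      dsimp only
      omega
  exact ⟨⟨_, hbinding⟩, hbinding⟩
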